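/- **Setting.** Fix a set of variables, a set of values, and an imperative language whose operations are assume operations and assignments. A data state $c$ maps variables to values. $c\models b$ says that $c$ satisfies the assume operation $b$, and $SP_a(c)$ is the data state after the (always executable) assignment $a$. Every assignment $a$ has a set $\mathrm{wr}(a)$ of variables such that $a$ changes no variable outside $\mathrm{wr}(a)$. Every operation $op$ has a set $\mathrm{rd}(op)$ of variables such that, if $c,c'$ agree on $\mathrm{rd}(op)$, then $c\models op\Leftrightarrow c'\models op$ (assume), respectively $SP_{op}(c)$ and $SP_{op}(c')$ agree on $\mathrm{wr}(op)$ (assignment). A *control-flow automaton* (CFA) $P=(L,\ell_0,G,\ell_{err})$ has locations $L$, $\ell_0,\ell_{err}\in L$, and edges $G\subseteq L\times Ops\times L$. It is *deterministic* if any two edges $(\ell,op_1,\ell_1),(\ell,op_2,\ell_2)\in G$ satisfy either $op_1=op_2$ and $\ell_1=\ell_2$, or $op_1,op_2$ are assume operations with $op_1\equiv\neg op_2$. An *executable path* $(\ell_0,c_0)\xrightarrow{g_1}\cdots\xrightarrow{g_n}(\ell_n,c_n)$, $n\ge 0$, starts in the initial location with an arbitrary $c_0$, and for all $i$, $g_i=(\ell_{i-1},op_i,\ell_i)\in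 G$ with $c_{i-1}\models op_i$, $c_i=c_{i-1}$ (assume) or $c_i=SP_{op_i}(c_{i-1})$ (assignment). It is *erroneous* if some $\ell_i=\ell_{err}$. For CFAs $P$ and $P'=(L',\ell_0',G',\ell_{err}')$, $paths^{rb}(P,P')$ is the set of erroneous executable paths of $P'$ for which no erroneous executable path of $P$ starts with the same data state. A *difference graph* for $P,P'$ is a tuple $(N,E,n_0,\Delta)$ with $n_0\in N$, $\Delta\subseteq N$, $E\subseteq N\times G'\times N$ such that for every path in $paths^{rb}(P,P')$ with edges $g_1',\dots,g_n'$, every $0\le k\le n$ and every path $n_0\xrightarrow{g_1'}\cdots\xrightarrow{g_k'}n_k$ in the graph there is a (possibly empty) path in the graph from $n_k$ to a node of $\Delta$. **Detector.** Start with $\mathit{wait}=\mathit{visited}=\{(\ell_0,\ell_0')\}$, $\mathit{edges}=\Delta=\emptyset$ and $\mathit{mod}(n)=\emptyset$ for all $n\in L\times L'$. While $\mathit{wait}\ne\emptyset$, pop some $n=(\ell_1,\ell_1')$ from it and do the following, in some order, for each $g'=(\ell_1',op',\ell_2')\in G'$. * $op'$ is an assignment. If there is $(\ell_1,op',\ell_2)\in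 G$, call $\mathrm{process}(n,g',(\ell_2,\ell_2'),V)$, where $V=\mathit{mod}(n)\cup \mathrm{wr}(op')$ if $\mathit{mod}(n)\cap \mathrm{rd}(op')\neq\emptyset$ and $V=\mathit{mod}(n)\setminus \mathrm{wr}(op')$ otherwise. If there is no such edge, call $\mathrm{process}(n,g',(\ell_1,\ell_2'),\mathit{mod}(n)\cup \mathrm{wr}(op'))$. * $op'$ is an assume operation. Put $\ell_p=\ell_1$, $V=\mathit{mod}(n)$; while $\ell_p\ne\ell_{err}$ and there is an assignment edge $(\ell_p,a,\ell_s)\in G$, set $\ell_p:=\ell_s$, $V:=V\cup \mathrm{wr}(a)$. If then $\ell_p\neq\ell_{err}$ and there is $(\ell_p,op,\ell_2)\in G$ with $op=op'$, or with $op'\Rightarrow op$ and $op'$ satisfiable, call $\mathrm{process}(n,g',\ell_2',\emptyset)$ if $V\cap(\mathrm{rd}(op)\cup \mathrm{rd}(op'))\ne\emptyset$, and $\mathrm{process}(n,g',(\ell_2,\ell_2'),V)$ otherwise. If there is no such edge or $\ell_p=\ell_{err}$, call $\mathrm{process}(n,g',(\ell_p,\ell_2'),V)$. $\mathrm{process}(n,g',t,V)$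 with $t\in L'$: add $t$ to $\Delta$ and $(n,g',t)$ to $\mathit{edges}$, and remove all pairs with second component $t$ from $\mathit{visited}$ and $\mathit{wait}$. With $t=(\ell,\ell')\in L\times L'$: if $\ell\ne\ell_{err}$ and $\ell'=\ell'_{err}$, call $\mathrm{process}(n,g',\ell'_{err},\emptyset)$. Otherwise, if $\ell'\notin\Delta$, first add $t$ to $\mathit{wait}$ provided that $\ell\neq\ell_{err}$ and ($t\notin\mathit{visited}$ or $V\not\subseteq \mathit{mod}(t)$), then add $t$ to $\mathit{visited}$ and $V$ to $\mathit{mod}(t)$; in any case (also if $\ell'\in\Delta$) add $(n,g',t)$ to $\mathit{edges}$. When $\mathit{wait}=\emptyset$: if $\ell_0'\in\Delta$, or $\ell_0'=\ell_{err}'$ and $\ell_0\ne\ell_{err}$, return $(\{\ell_0'\},\emptyset,\ell_0',\{\ell_0'\})$. Otherwise return $(\mathit{visited}\cup\Delta,E,(\ell_0,\ell_0'),\Delta)$, where $E$ is the set of $(n,g',t)\in\mathit{visited}\times G'\times(\mathit{visited}\cup\Delta)$ such that $(n,g',t)\in\mathit{edges}$, or $t\in\Delta$ and $(n,g',(\ell,t))\in\mathit{edges}$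 for some $\ell\in L$. **Theorem.** Let $P$ and $P'$ be deterministic CFAs. Whenever the detector, run on $P$ and $P'$ with any order of exploration, terminates, the graph it returns is a difference graph for $P$ and $P'$. -/

import Mathlib

namespace DiffVerif

/-- An operation of the programming language: an assume operation (given by its condition)
or an assignment. -/
inductive Op (Cond Asgn : Type*) where
  | assume (b : Cond)
  | assign (a : Asgn)

/-- Semantics of an imperative language with assume operations `Cond` and assignments `Asgn` over
data states `Var → Val`.  `Sat c b` is `c ⊨ b`; `post a` is the strongest-post operator of `a` on
single data states.  The read and write sets are any sets with the characterizing properties: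
an assignment changes only variables in its write set, and agreement on the read set determines
the truth of a condition, respectively the values an assignment writes. -/
structure Semantics (Var Val Cond Asgn : Type*) where
  Sat : (Var → Val) → Cond → Prop
  post : Asgn → (Var → Val) → (Var → Val)
  rdCond : Cond → Set Var
  rdAsgn : Asgn → Set Var
  writ : Asgn → Set Var
  post_eq_of_notMem_writ : ∀ a c x, x ∉ writ a → post a c x = c x
  sat_congr : ∀ b c c', (∀ x ∈ rdCond b, c x = c' x) → (Sat c b ↔ Sat c' b)
  post_congr : ∀ a c c', (∀ x ∈ rdAsgn a, c x = c' x) → ∀ x ∈ writ a, post a c x = post a c' x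

/-- Syntactic control-flow edges `(ℓ, op, ℓ')`. -/
abbrev Edge (Loc Cond Asgn : Type*) := Loc × Op Cond Asgn × Loc

/-- Control-flow automata with location set `Loc`. -/
structure CFA (Loc Cond Asgn : Type*) where
  init : Loc
  err : Loc
  edges : Set (Edge Loc Cond Asgn)

section Programs

variable {Var Val Cond Asgn Loc Loc' : Type*}

/-- Any two edges leaving the same location are equal, or carry assume operations that are
(semantically) negations of each other. -/
def CFA.Deterministic (S : Semantics Var Val Cond Asgn) (P : CFA Loc Cond Asgn) : Prop :=
  ∀ ℓ op₁ ℓ₁ op₂ ℓ₂, (ℓ, op₁, ℓ₁) ∈ P.edges → (ℓ, op₂, ℓ₂) ∈ P.edges →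
    (op₁ = op₂ ∧ ℓ₁ = ℓ₂) ∨
    ∃ b₁ b₂, op₁ = .assume b₁ ∧ op₂ = .assume b₂ ∧ ∀ c, S.Sat c b₁ ↔ ¬ S.Sat c b₂

/-- Effect of executing one operation on the data state. -/
def OpStep (S : Semantics Var Val Cond Asgn) : Op Cond Asgn → (Var → Val) → (Var → Val) → Prop
  | .assume b, c, c' => S.Sat c b ∧ c' = c
  | .assign a, c, c' => c' = S.post a c

/-- Executable program paths `(loc 0, data 0) → … → (loc len, data len)`, where step `i` (counted
from `0`) takes the edge `edge i`.  The values of `loc`, `data` beyond `len` and of `edge` from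
`len` on carry no meaning. -/
structure ExecPath (S : Semantics Var Val Cond Asgn) (P : CFA Loc Cond Asgn) where
  len : ℕ
  loc : ℕ → Loc
  data : ℕ → Var → Val
  edge : ℕ → Edge Loc Cond Asgn
  loc_zero : loc 0 = P.init
  edge_mem : ∀ i < len, edge i ∈ P.edges
  edge_src : ∀ i < len, (edge i).1 = loc i
  edge_tgt : ∀ i < len, (edge i).2.2 = loc (i + 1)
  step : ∀ i < len, OpStep S (edge i).2.1 (data i) (data (i + 1))

/-- Executable paths that reach the error location. -/
def pathsErr (S : Semantics Var Val Cond Asgn) (P : CFA Loc Cond Asgn) : Set (ExecPath S P) :=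
  {π | ∃ i ≤ π.len, π.loc i = P.err}

/-- Paths of the modified program `P'` with a regression bug relative to `P`. -/
def pathsRB (S : Semantics Var Val Cond Asgn) (P : CFA Loc Cond Asgn) (P' : CFA Loc' Cond Asgn) :
    Set (ExecPath S P') :=
  {π' | π' ∈ pathsErr S P' ∧ ¬ ∃ π ∈ pathsErr S P, π'.data 0 = π.data 0}

end Programs

/-- A graph with nodes, labelled edges, an initial node, and indicator nodes `Δ`. -/
structure Graph (Node Label : Type*) where
  nodes : Set Node
  edges : Set (Node × Label × Node)
  init : Node
  Δ : Set Node

/-- `node 0 → … → node k` is a path of the graph with labels `label 0, …, label (k - 1)`. -/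
def Graph.IsWalk {Node Label : Type*} (D : Graph Node Label)
    (k : ℕ) (node : ℕ → Node) (label : ℕ → Label) : Prop :=
  (∀ i ≤ k, node i ∈ D.nodes) ∧ ∀ i < k, (node i, label i, node (i + 1)) ∈ D.edges

/-- `D` is a difference graph for original `P` and modified `P'`. -/
structure IsDifferenceGraph {Var Val Cond Asgn Loc Loc' Node : Type*}
    (S : Semantics Var Val Cond Asgn) (P : CFA Loc Cond Asgn) (P' : CFA Loc' Cond Asgn)
    (D : Graph Node (Edge Loc' Cond Asgn)) : Prop where
  init_mem : D.init ∈ D.nodes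
  indicator_subset : D.Δ ⊆ D.nodes
  edges_subset : ∀ n g n', (n, g, n') ∈ D.edges → n ∈ D.nodes ∧ g ∈ P'.edges ∧ n' ∈ D.nodes
  sound : ∀ π' ∈ pathsRB S P P', ∀ k ≤ π'.len, ∀ node : ℕ → Node,
    node 0 = D.init → D.IsWalk k node π'.edge →
      ∃ (m : ℕ) (node' : ℕ → Node) (label' : ℕ → Edge Loc' Cond Asgn),
        node' 0 = node k ∧ D.IsWalk m node' label' ∧ node' m ∈ D.Δ

/-! ### The difference detector -/

/-- Nodes handled by the detector: alignment points `(ℓ, ℓ')`, or a bare location `ℓ'` of the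
modified program (a regression bug indicator node). -/
inductive Node (Loc Loc' : Type*) where
  | aligned (n : Loc × Loc')
  | indicator (ℓ' : Loc')

/-- Values of the program variables of the detector. -/
structure State (Var Cond Asgn Loc Loc' : Type*) where
  waitlist : Set (Loc × Loc')
  visited : Set (Loc × Loc')
  edges : Set (Node Loc Loc' × Edge Loc' Cond Asgn × Node Loc Loc')
  bad : Set Loc'
  modified : Loc × Loc' → Set Var

section Detector

variable {Var Val Cond Asgn Loc Loc' : Type*}

/-- Initialization. -/
def State.start (P : CFA Loc Cond Asgn) (P' : CFA Loc' Cond Asgn) :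
    State Var Cond Asgn Loc Loc' where
  waitlist := {(P.init, P'.init)}
  visited := {(P.init, P'.init)}
  edges := ∅
  bad := ∅
  modified := fun _ => ∅

/-- Procedure `process` for a successor that is a location `ℓ'` of the modified program. -/
def State.processIndicator (s : State Var Cond Asgn Loc Loc') (pred : Loc × Loc')
    (g' : Edge Loc' Cond Asgn) (ℓ' : Loc') : State Var Cond Asgn Loc Loc' where
  waitlist := s.waitlist \ {n | n.2 = ℓ'}
  visited := s.visited \ {n | n.2 = ℓ'}
  edges := s.edges ∪ {(.aligned pred, g', .indicator ℓ')}
  bad := s.bad ∪ {ℓ'}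
  modified := s.modified

open Classical in
/-- Procedure `process (pred, g', succ) Vdiff`. -/
noncomputable def State.process (P : CFA Loc Cond Asgn) (P' : CFA Loc' Cond Asgn)
    (s : State Var Cond Asgn Loc Loc') (pred : Loc × Loc') (g' : Edge Loc' Cond Asgn)
    (succ : Node Loc Loc') (Vdiff : Set Var) : State Var Cond Asgn Loc Loc' :=
  match succ with
  | .indicator ℓ' => s.processIndicator pred g' ℓ'
  | .aligned n =>
    if n.1 ≠ P.err ∧ n.2 = P'.err then s.processIndicator pred g' P'.err
    else
      { waitlist :=
          if n.2 ∉ s.bad ∧ n.1 ≠ P.err ∧ (n ∉ s.visited ∨ ¬ Vdiff ⊆ s.modified n)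
          then s.waitlist ∪ {n} else s.waitlist
        visited := if n.2 ∉ s.bad then s.visited ∪ {n} else s.visited
        edges := s.edges ∪ {(.aligned pred, g', .aligned n)}
        bad := s.bad
        modified := fun k =>
          if k = n ∧ n.2 ∉ s.bad then s.modified k ∪ Vdiff else s.modified k }

/-- The resynchronization loop: starting with `ℓp = ℓ` and `Vdiff = V`, skip assignments of `P`
until the error location or a location without outgoing assignment is reached; the loop ends with
the last two arguments as values of `ℓp` and `Vdiff`. -/
inductive Resync (S : Semantics Var Val Cond Asgn) (P : CFA Loc Cond Asgn) :
    Loc → Set Var → Loc → Set Var → Prop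
  | done {ℓ V} : ¬ (ℓ ≠ P.err ∧ ∃ a ℓs, (ℓ, Op.assign a, ℓs) ∈ P.edges) → Resync S P ℓ V ℓ V
  | skip {ℓ V a ℓs ℓp W} : ℓ ≠ P.err → (ℓ, Op.assign a, ℓs) ∈ P.edges →
      Resync S P ℓs (V ∪ S.writ a) ℓp W → Resync S P ℓ V ℓp W

/-- The assume operation `b` of the original program matches the assume operation `b'`:
identical, or more general with `b'` satisfiable. -/
def Matches (S : Semantics Var Val Cond Asgn) (b b' : Cond) : Prop :=
  b = b' ∨ ((∀ c, S.Sat c b' → S.Sat c b) ∧ ∃ c, S.Sat c b')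

/-- Body of the for-loop: `ExploreEdge S P P' n g' s t` says that exploring the edge `g'` from the
popped alignment point `n` in detector state `s` may end in state `t`. -/
inductive ExploreEdge (S : Semantics Var Val Cond Asgn)
    (P : CFA Loc Cond Asgn) (P' : CFA Loc' Cond Asgn) (n : Loc × Loc') :
    Edge Loc' Cond Asgn → State Var Cond Asgn Loc Loc' → State Var Cond Asgn Loc Loc' → Prop
  | assignMatchAffected {s a ℓ₂ ℓ₂'} :
      (n.1, Op.assign a, ℓ₂) ∈ P.edges → s.modified n ∩ S.rdAsgn a ≠ ∅ →
      ExploreEdge S P P' n (n.2, .assign a, ℓ₂') s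
        (s.process P P' n (n.2, .assign a, ℓ₂') (.aligned (ℓ₂, ℓ₂')) (s.modified n ∪ S.writ a))
  | assignMatchUnaffected {s a ℓ₂ ℓ₂'} :
      (n.1, Op.assign a, ℓ₂) ∈ P.edges → s.modified n ∩ S.rdAsgn a = ∅ →
      ExploreEdge S P P' n (n.2, .assign a, ℓ₂') s
        (s.process P P' n (n.2, .assign a, ℓ₂') (.aligned (ℓ₂, ℓ₂')) (s.modified n \ S.writ a))
  | assignNew {s a ℓ₂'} :
      (¬ ∃ ℓ₂, (n.1, Op.assign a, ℓ₂) ∈ P.edges) →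
      ExploreEdge S P P' n (n.2, .assign a, ℓ₂') s
        (s.process P P' n (n.2, .assign a, ℓ₂') (.aligned (n.1, ℓ₂')) (s.modified n ∪ S.writ a))
  | assumeMatchAffected {s b' ℓ₂' ℓp Vdiff b ℓ₂} :
      Resync S P n.1 (s.modified n) ℓp Vdiff →
      ℓp ≠ P.err → (ℓp, Op.assume b, ℓ₂) ∈ P.edges → Matches S b b' →
      Vdiff ∩ (S.rdCond b ∪ S.rdCond b') ≠ ∅ →
      ExploreEdge S P P' n (n.2, .assume b', ℓ₂') s
        (s.process P P' n (n.2, .assume b', ℓ₂') (.indicator ℓ₂') ∅)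
  | assumeMatchUnaffected {s b' ℓ₂' ℓp Vdiff b ℓ₂} :
      Resync S P n.1 (s.modified n) ℓp Vdiff →
      ℓp ≠ P.err → (ℓp, Op.assume b, ℓ₂) ∈ P.edges → Matches S b b' →
      Vdiff ∩ (S.rdCond b ∪ S.rdCond b') = ∅ →
      ExploreEdge S P P' n (n.2, .assume b', ℓ₂') s
        (s.process P P' n (n.2, .assume b', ℓ₂') (.aligned (ℓ₂, ℓ₂')) Vdiff)
  | assumeNew {s b' ℓ₂' ℓp Vdiff} :
      Resync S P n.1 (s.modified n) ℓp Vdiff →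
      ¬ (ℓp ≠ P.err ∧ ∃ b ℓ₂, (ℓp, Op.assume b, ℓ₂) ∈ P.edges ∧ Matches S b b') →
      ExploreEdge S P P' n (n.2, .assume b', ℓ₂') s
        (s.process P P' n (n.2, .assume b', ℓ₂') (.aligned (ℓp, ℓ₂')) Vdiff)

/-- Exploring a list of edges one after the other. -/
inductive ExploreEdges (S : Semantics Var Val Cond Asgn)
    (P : CFA Loc Cond Asgn) (P' : CFA Loc' Cond Asgn) (n : Loc × Loc') :
    List (Edge Loc' Cond Asgn) →
      State Var Cond Asgn Loc Loc' → State Var Cond Asgn Loc Loc' → Prop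
  | nil {s} : ExploreEdges S P P' n [] s s
  | cons {g' gs s t u} : ExploreEdge S P P' n g' s t → ExploreEdges S P P' n gs t u →
      ExploreEdges S P P' n (g' :: gs) s u

/-- One iteration of the outer while-loop: pop some element of the waitlist and explore, in some
order, every edge of the modified program that leaves its second component. -/
def Iteration (S : Semantics Var Val Cond Asgn)
    (P : CFA Loc Cond Asgn) (P' : CFA Loc' Cond Asgn)
    (s t : State Var Cond Asgn Loc Loc') : Prop :=
  ∃ n ∈ s.waitlist, ∃ gs : List (Edge Loc' Cond Asgn),
    gs.Nodup ∧ (∀ g', g' ∈ gs ↔ g' ∈ P'.edges ∧ g'.1 = n.2) ∧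
    ExploreEdges S P P' n gs { s with waitlist := s.waitlist \ {n} } t

open Classical in
/-- Construction of the returned graph from the final detector state. -/
noncomputable def State.output (P : CFA Loc Cond Asgn) (P' : CFA Loc' Cond Asgn)
    (s : State Var Cond Asgn Loc Loc') : Graph (Node Loc Loc') (Edge Loc' Cond Asgn) :=
  if P'.init ∈ s.bad ∨ (P'.init = P'.err ∧ P.init ≠ P.err) then
    { nodes := {.indicator P'.init}
      edges := ∅
      init := .indicator P'.init
      Δ := {.indicator P'.init} }
  else
    { nodes := Node.aligned '' s.visited ∪ Node.indicator '' s.bad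
      edges := {e | e.1 ∈ Node.aligned '' s.visited ∧ e.2.1 ∈ P'.edges ∧
        e.2.2 ∈ Node.aligned '' s.visited ∪ Node.indicator '' s.bad ∧
        (e ∈ s.edges ∨
          ∃ ℓ' ∈ s.bad, e.2.2 = .indicator ℓ' ∧
            ∃ ℓ, (e.1, e.2.1, Node.aligned (ℓ, ℓ')) ∈ s.edges)}
      init := .aligned (P.init, P'.init)
      Δ := Node.indicator '' s.bad }

/-- `D` is returned by some (terminating) run of the detector on `P` and `P'`. -/
def DetectorReturns (S : Semantics Var Val Cond Asgn)
    (P : CFA Loc Cond Asgn) (P' : CFA Loc' Cond Asgn)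
    (D : Graph (Node Loc Loc') (Edge Loc' Cond Asgn)) : Prop :=
  ∃ s : State Var Cond Asgn Loc Loc',
    Relation.ReflTransGen (Iteration S P P') (State.start P P') s ∧
    s.waitlist = ∅ ∧ D = s.output P P'

end Detector

end DiffVerif

/- The detector state keeps, for every finished alignment point `n = (ℓ, ℓ')` and every edge `g'`
of `P'` leaving `ℓ'`, one of two facts: `g'` leads to an indicator, or it leads to a visited point
`m` such that whenever `P` sits at `ℓ` with a data state that differs from that of `P'` only in
`mod(n)`, the step along `g'` can be answered by an execution of `P` to the first component of `m`,
the data states then differing only in `mod(m)`. Hence along any walk of the returned graph that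
follows an execution of `P'` from a data state `c₀`, `P` can be executed from `c₀` alongside, until
an indicator is reached. If `P` has no erroneous execution from `c₀`, this companion execution never
reaches the error location of `P`, and alignment points of the error location of `P'` with another
location of `P` have been replaced by indicators. So an erroneous execution of `P'` is stopped by an
indicator before it reaches the error location. -/

namespace DiffVerif

open Relation Set

theorem exists_seq_of_reflTransGen {α : Type*} {r : α → α → Prop} {a b : α}
    (h : ReflTransGen r a b) :
    ∃ (k : ℕ) (f : ℕ → α), f 0 = a ∧ f k = b ∧ ∀ i < k, r (f i) (f (i + 1)) := by
  induction h using ReflTransGen.head_induction_on with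
  | refl => exact ⟨0, fun _ => b, rfl, rfl, by simp⟩
  | @head a _ hac _ ih =>
    obtain ⟨k, f, rfl, hk, hf⟩ := ih
    refine ⟨k + 1, fun i => i.casesOn a f, rfl, hk, ?_⟩
    rintro (_ | i) hi
    exacts [hac, hf i (Nat.lt_of_succ_lt_succ hi)]

/-! ### Executions -/

section Executions

variable {Var Val Cond Asgn Loc Loc' : Type*} {S : Semantics Var Val Cond Asgn}
  {P : CFA Loc Cond Asgn} {P' : CFA Loc' Cond Asgn}

/-- The small-step transition relation of `P` on configurations `(ℓ, c)`. -/
def CFA.Step (S : Semantics Var Val Cond Asgn) (P : CFA Loc Cond Asgn)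
    (x y : Loc × (Var → Val)) : Prop :=
  ∃ op, (x.1, op, y.1) ∈ P.edges ∧ OpStep S op x.2 y.2

/-- `P` is safe from `c₀` if no execution starting with the data state `c₀` is erroneous. -/
def CFA.Safe (S : Semantics Var Val Cond Asgn) (P : CFA Loc Cond Asgn) (c₀ : Var → Val) : Prop :=
  ∀ c, ¬ ReflTransGen (P.Step S) (P.init, c₀) (P.err, c)

theorem ExecPath.edge_eq (π : ExecPath S P) {i : ℕ} (hi : i < π.len) :
    π.edge i = (π.loc i, (π.edge i).2.1, π.loc (i + 1)) := by
  rw [← π.edge_src i hi, ← π.edge_tgt i hi]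

theorem ExecPath.reflTransGen_step (π : ExecPath S P) {i j : ℕ} (hij : i ≤ j) (hj : j ≤ π.len) :
    ReflTransGen (P.Step S) (π.loc i, π.data i) (π.loc j, π.data j) := by
  induction j, hij using Nat.le_induction with
  | base => exact .refl
  | succ j _ ih =>
    exact (ih (Nat.le_of_succ_le hj)).tail
      ⟨_, π.edge_eq hj ▸ π.edge_mem j hj, π.step j hj⟩

theorem exists_execPath_of_reflTransGen [Nonempty (Op Cond Asgn)] {c₀ c : Var → Val} {ℓ : Loc}
    (h : ReflTransGen (P.Step S) (P.init, c₀) (ℓ, c)) :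
    ∃ π : ExecPath S P, π.data 0 = c₀ ∧ π.loc π.len = ℓ := by
  obtain ⟨k, f, h0, hk, hf⟩ := exists_seq_of_reflTransGen h
  have hop : ∀ i, ∃ op, i < k →
      ((f i).1, op, (f (i + 1)).1) ∈ P.edges ∧ OpStep S op (f i).2 (f (i + 1)).2 := fun i => by
    by_cases hi : i < k
    · exact (hf i hi).imp fun _ h _ => h
    · exact ⟨Classical.ofNonempty, fun h => absurd h hi⟩
  choose op hop using hop
  exact ⟨{  len := k
            loc := fun i => (f i).1
            data := fun i => (f i).2
            edge := fun i => ((f i).1, op i, (f (i + 1)).1)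
            loc_zero := congrArg Prod.fst h0
            edge_mem := fun i hi => (hop i hi).1
            edge_src := fun _ _ => rfl
            edge_tgt := fun _ _ => rfl
            step := fun i hi => (hop i hi).2 },
    congrArg Prod.snd h0, congrArg Prod.fst hk⟩

theorem safe_of_mem_pathsRB {π' : ExecPath S P'} (hπ' : π' ∈ pathsRB S P P') :
    P.Safe S (π'.data 0) := by
  intro c h
  have : Nonempty (Op Cond Asgn) := ⟨(π'.edge 0).2.1⟩
  obtain ⟨π, h0, herr⟩ := exists_execPath_of_reflTransGen h
  exact hπ'.2 ⟨π, ⟨π.len, le_rfl, herr⟩, h0.symm⟩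

end Executions

/-! ### Difference graphs from simulations -/

section Simulation

variable {Var Val Cond Asgn Loc Loc' Node Label : Type*} {S : Semantics Var Val Cond Asgn}
  {P : CFA Loc Cond Asgn} {P' : CFA Loc' Cond Asgn}

/-- The adjacency relation of a graph, forgetting labels. -/
def Graph.Adj (D : Graph Node Label) (n m : Node) : Prop :=
  ∃ l, (n, l, m) ∈ D.edges

theorem Graph.exists_isWalk_of_reflTransGen [Nonempty Label] {D : Graph Node Label} {n m : Node}
    (hD : ∀ n l m, (n, l, m) ∈ D.edges → n ∈ D.nodes) (hm : m ∈ D.nodes)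
    (h : ReflTransGen D.Adj n m) :
    ∃ (k : ℕ) (node : ℕ → Node) (label : ℕ → Label),
      node 0 = n ∧ D.IsWalk k node label ∧ node k = m := by
  obtain ⟨k, node, h0, rfl, hadj⟩ := exists_seq_of_reflTransGen h
  have hlabel : ∀ i, ∃ l, i < k → (node i, l, node (i + 1)) ∈ D.edges := fun i => by
    by_cases hi : i < k
    · exact (hadj i hi).imp fun _ h _ => h
    · exact ⟨Classical.ofNonempty, fun h => absurd h hi⟩
  choose label hlabel using hlabel
  refine ⟨k, node, label, h0, ⟨fun i hi => ?_, hlabel⟩, rfl⟩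
  rcases hi.lt_or_eq with hi | rfl
  exacts [hD _ _ _ (hlabel i hi), hm]

/-- `R` relates the nodes of the graph `D` to configurations of `P'` in such a way that `D` can
follow every execution of `P'` until it arrives at an indicator, and `P'` is not in its error
location before that. -/
structure Graph.IsSimulation (S : Semantics Var Val Cond Asgn) (P' : CFA Loc' Cond Asgn)
    (D : Graph Node (Edge Loc' Cond Asgn)) (R : Node → Loc' × (Var → Val) → Prop) : Prop where
  ne_err {n : Node} {x : Loc' × (Var → Val)} : R n x → n ∉ D.Δ → x.1 ≠ P'.err
  exists_edge {n : Node} {x y : Loc' × (Var → Val)} {op : Op Cond Asgn} : R n x → n ∉ D.Δ →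
    (x.1, op, y.1) ∈ P'.edges → OpStep S op x.2 y.2 → ∃ m, (n, (x.1, op, y.1), m) ∈ D.edges
  step {n m : Node} {x y : Loc' × (Var → Val)} {op : Op Cond Asgn} : R n x →
    (n, (x.1, op, y.1), m) ∈ D.edges → OpStep S op x.2 y.2 → R m y

variable {D : Graph Node (Edge Loc' Cond Asgn)} {R : Node → Loc' × (Var → Val) → Prop}

theorem Graph.IsSimulation.exists_reflTransGen_adj (hR : D.IsSimulation S P' R) {n : Node}
    {x : Loc' × (Var → Val)} {c : Var → Val} (hx : ReflTransGen (P'.Step S) x (P'.err, c))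
    (hn : R n x) : ∃ d ∈ D.Δ, ReflTransGen D.Adj n d := by
  induction hx using ReflTransGen.head_induction_on generalizing n with
  | refl =>
    by_contra! hno
    exact hR.ne_err hn (fun hΔ => hno n hΔ .refl) rfl
  | head hxy _ ih =>
    by_cases hΔ : n ∈ D.Δ
    · exact ⟨n, hΔ, .refl⟩
    obtain ⟨op, hop, hstep⟩ := hxy
    obtain ⟨m, hm⟩ := hR.exists_edge hn hΔ hop hstep
    obtain ⟨d, hd, hmd⟩ := ih (hR.step hn hm hstep)
    exact ⟨d, hd, hmd.head ⟨_, hm⟩⟩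

theorem Graph.IsSimulation.rel_of_isWalk (hR : D.IsSimulation S P' R) {π' : ExecPath S P'} {k : ℕ}
    {node : ℕ → Node} (hk : k ≤ π'.len) (h0 : R (node 0) (π'.loc 0, π'.data 0))
    (hwalk : D.IsWalk k node π'.edge) {i : ℕ} (hi : i ≤ k) :
    R (node i) (π'.loc i, π'.data i) := by
  induction i with
  | zero => exact h0
  | succ i ih =>
    have hlen : i < π'.len := Nat.lt_of_lt_of_le hi hk
    exact hR.step (ih (Nat.le_of_succ_le hi)) (π'.edge_eq hlen ▸ hwalk.2 i hi) (π'.step i hlen)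

theorem isDifferenceGraph_of_isSimulation (init_mem : D.init ∈ D.nodes)
    (indicator_subset : D.Δ ⊆ D.nodes)
    (edges_subset : ∀ n g m, (n, g, m) ∈ D.edges → n ∈ D.nodes ∧ g ∈ P'.edges ∧ m ∈ D.nodes)
    (notMem_indicator : ∀ n g m, (n, g, m) ∈ D.edges → n ∉ D.Δ)
    (exists_sim : ∀ c₀, P.Safe S c₀ → ∃ R, D.IsSimulation S P' R ∧ R D.init (P'.init, c₀)) :
    IsDifferenceGraph S P P' D where
  init_mem := init_mem
  indicator_subset := indicator_subset
  edges_subset := edges_subset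
  sound π' hπ' k hk node h0 hwalk := by
    obtain ⟨j, hj, herr⟩ := hπ'.1
    obtain ⟨R, hR, hinit⟩ := exists_sim _ (safe_of_mem_pathsRB hπ')
    rw [← h0, ← π'.loc_zero] at hinit
    have hrel {i : ℕ} (hi : i ≤ k) : R (node i) (π'.loc i, π'.data i) :=
      hR.rel_of_isWalk hk hinit hwalk hi
    -- Indicators have no successors, so the walk cannot outlast the error.
    have hkj : k ≤ j := by
      by_contra! hjk
      exact hR.ne_err (hrel hjk.le) (notMem_indicator _ _ _ (hwalk.2 j hjk)) herr
    obtain ⟨d, hd, hkd⟩ :=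
      hR.exists_reflTransGen_adj (herr ▸ π'.reflTransGen_step hkj hj) (hrel le_rfl)
    have : Nonempty (Edge Loc' Cond Asgn) := ⟨π'.edge 0⟩
    obtain ⟨m, node', label', h0', hwalk', rfl⟩ := Graph.exists_isWalk_of_reflTransGen
      (fun n g m h => (edges_subset n g m h).1) (indicator_subset hd) hkd
    exact ⟨m, node', label', h0', hwalk', hd⟩

theorem isDifferenceGraph_singleton (S : Semantics Var Val Cond Asgn) (P : CFA Loc Cond Asgn)
    (P' : CFA Loc' Cond Asgn) (n : Node) : IsDifferenceGraph S P P' ⟨{n}, ∅, n, {n}⟩ :=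
  isDifferenceGraph_of_isSimulation rfl subset_rfl (fun _ _ _ h => h.elim) (fun _ _ _ h => h.elim)
    fun _ _ => ⟨fun m _ => m ∈ ({n} : Set Node),
      ⟨fun h hm => absurd h hm, fun h hm => absurd h hm, fun _ h => h.elim⟩, rfl⟩

end Simulation

/-! ### Answering a step of the modified program -/

section Answers

variable {Var Val Cond Asgn Loc Loc' : Type*} {S : Semantics Var Val Cond Asgn}
  {P : CFA Loc Cond Asgn} {ℓ ℓ₁ ℓ₂ ℓp : Loc} {V V₁ V₂ W W₁ W₂ : Set Var} {a : Asgn} {b b' : Cond}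
  {c c' : Var → Val}

theorem Semantics.eqOn_post_left (S : Semantics Var Val Cond Asgn) (a : Asgn)
    (h : EqOn c c' Vᶜ) : EqOn (S.post a c) c' (V ∪ S.writ a)ᶜ := by
  rw [compl_union]
  exact fun x hx => (S.post_eq_of_notMem_writ a c x hx.2).trans (h hx.1)

theorem Semantics.eqOn_post_post (S : Semantics Var Val Cond Asgn) (a : Asgn)
    (h : EqOn c c' Vᶜ) : EqOn (S.post a c) (S.post a c') (V ∪ S.writ a)ᶜ := by
  simpa only [union_assoc, union_self] using (S.eqOn_post_left a (S.eqOn_post_left a h).symm).symm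

theorem Semantics.eqOn_post_post_diff (S : Semantics Var Val Cond Asgn) (h : EqOn c c' Vᶜ)
    (hV : Disjoint V (S.rdAsgn a)) : EqOn (S.post a c) (S.post a c') (V \ S.writ a)ᶜ := by
  intro x hx
  by_cases hw : x ∈ S.writ a
  · exact S.post_congr a c c' (fun _ hy => h (hV.subset_compl_left hy)) x hw
  · exact S.eqOn_post_post a h (by simp_all)

theorem Matches.sat (h : Matches S b b') (hc : S.Sat c b') : S.Sat c b := by
  rcases h with rfl | ⟨h, -⟩
  exacts [hc, h c hc]

theorem CFA.Deterministic.eq_of_assign (hP : P.Deterministic S) {op : Op Cond Asgn}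
    (h₁ : (ℓ, .assign a, ℓ₁) ∈ P.edges) (h₂ : (ℓ, op, ℓ₂) ∈ P.edges) : ℓ₁ = ℓ₂ := by
  rcases hP _ _ _ _ _ h₁ h₂ with ⟨-, h⟩ | ⟨_, _, h, -⟩
  exacts [h, nomatch h]

theorem CFA.Deterministic.eq_of_sat {b₁ b₂ : Cond} (hP : P.Deterministic S)
    (h₁ : (ℓ, .assume b₁, ℓ₁) ∈ P.edges) (h₂ : (ℓ, .assume b₂, ℓ₂) ∈ P.edges)
    (hc₁ : S.Sat c b₁) (hc₂ : S.Sat c b₂) : ℓ₁ = ℓ₂ := by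
  rcases hP _ _ _ _ _ h₁ h₂ with ⟨-, h⟩ | ⟨_, _, ⟨⟩, ⟨⟩, hneg⟩
  exacts [h, absurd hc₂ ((hneg c).1 hc₁)]

theorem Resync.loc_unique (hP : P.Deterministic S) (h₁ : Resync S P ℓ V₁ ℓ₁ W₁)
    (h₂ : Resync S P ℓ V₂ ℓ₂ W₂) : ℓ₁ = ℓ₂ := by
  induction h₁ generalizing V₂ with
  | done hd =>
    cases h₂ with
    | done => rfl
    | skip hne he _ => exact absurd ⟨hne, _, _, he⟩ hd
  | skip hne he _ ih =>
    cases h₂ with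
    | done hd => exact absurd ⟨hne, _, _, he⟩ hd
    | skip _ he' h =>
      obtain rfl := hP.eq_of_assign he he'
      exact ih h

theorem Resync.exists_reflTransGen_step (h : Resync S P ℓ V ℓp W) (hc : EqOn c c' Vᶜ) :
    ∃ d, ReflTransGen (P.Step S) (ℓ, c) (ℓp, d) ∧ EqOn d c' Wᶜ := by
  induction h generalizing c with
  | done => exact ⟨c, .refl, hc⟩
  | @skip _ _ a _ _ _ _ he _ ih =>
    obtain ⟨d, hd, hdc⟩ := ih (S.eqOn_post_left a hc)
    exact ⟨d, hd.head (b := (_, S.post a c)) ⟨.assign a, he, rfl⟩, hdc⟩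

/-- The location of `P` with which the detector aligns the target of a step with operation `op` of
the modified program when the source of the step is aligned with `ℓ`.  In contrast to the set of
modified variables, it depends on nothing but `P`, which is why edges recorded by the detector never
become stale. -/
inductive AlignedSucc (S : Semantics Var Val Cond Asgn) (P : CFA Loc Cond Asgn) (ℓ : Loc) :
    Op Cond Asgn → Loc → Prop
  | assignMatch {a : Asgn} {ℓ₂ : Loc} : (ℓ, .assign a, ℓ₂) ∈ P.edges →
      AlignedSucc S P ℓ (.assign a) ℓ₂
  | assignNew {a : Asgn} : (¬ ∃ ℓ₂, (ℓ, .assign a, ℓ₂) ∈ P.edges) →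
      AlignedSucc S P ℓ (.assign a) ℓ
  | assumeMatch {b b' : Cond} {V W : Set Var} {ℓp ℓ₂ : Loc} : Resync S P ℓ V ℓp W → ℓp ≠ P.err →
      (ℓp, .assume b, ℓ₂) ∈ P.edges → Matches S b b' → AlignedSucc S P ℓ (.assume b') ℓ₂
  | assumeNew {b' : Cond} {V W : Set Var} {ℓp : Loc} : Resync S P ℓ V ℓp W →
      ¬ (ℓp ≠ P.err ∧ ∃ b ℓ₂, (ℓp, Op.assume b, ℓ₂) ∈ P.edges ∧ Matches S b b') →
      AlignedSucc S P ℓ (.assume b') ℓp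

theorem AlignedSucc.unique (hP : P.Deterministic S) {op : Op Cond Asgn} (hop : OpStep S op c c')
    (h₁ : AlignedSucc S P ℓ op ℓ₁) (h₂ : AlignedSucc S P ℓ op ℓ₂) : ℓ₁ = ℓ₂ := by
  cases h₁ with
  | assignMatch he₁ =>
    cases h₂ with
    | assignMatch he₂ => exact hP.eq_of_assign he₁ he₂
    | assignNew hn => exact absurd ⟨_, he₁⟩ hn
  | assignNew hn =>
    cases h₂ with
    | assignMatch he => exact absurd ⟨_, he⟩ hn
    | assignNew => rfl
  | assumeMatch hr₁ hne he₁ hm₁ =>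
    cases h₂ with
    | assumeMatch hr₂ _ he₂ hm₂ =>
      obtain rfl := hr₁.loc_unique hP hr₂
      exact hP.eq_of_sat he₁ he₂ (hm₁.sat hop.1) (hm₂.sat hop.1)
    | assumeNew hr₂ hn =>
      obtain rfl := hr₁.loc_unique hP hr₂
      exact absurd ⟨hne, _, _, he₁, hm₁⟩ hn
  | assumeNew hr₁ hn =>
    cases h₂ with
    | assumeMatch hr₂ hne he hm =>
      obtain rfl := hr₁.loc_unique hP hr₂
      exact absurd ⟨hne, _, _, he, hm⟩ hn
    | assumeNew hr₂ _ => exact hr₁.loc_unique hP hr₂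

/-- Every step with operation `op` from a data state that differs from that of `P` at `ℓ₁` only in
`V` can be answered by an execution of `P` to `ℓ₂`, the data states then differing only in `W`. -/
def Answers (S : Semantics Var Val Cond Asgn) (P : CFA Loc Cond Asgn) (ℓ₁ : Loc) (V : Set Var)
    (op : Op Cond Asgn) (ℓ₂ : Loc) (W : Set Var) : Prop :=
  ∀ ⦃c c' d'⦄, EqOn c c' Vᶜ → OpStep S op c' d' →
    ∃ d, ReflTransGen (P.Step S) (ℓ₁, c) (ℓ₂, d) ∧ EqOn d d' Wᶜ

theorem Answers.mono {op : Op Cond Asgn} (h : Answers S P ℓ₁ V op ℓ₂ W₁) (hW : W₁ ⊆ W₂) :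
    Answers S P ℓ₁ V op ℓ₂ W₂ := fun _ _ _ hc hop =>
  (h hc hop).imp fun _ hd => ⟨hd.1, hd.2.mono (compl_subset_compl.2 hW)⟩

theorem answers_assign_of_mem (he : (ℓ₁, .assign a, ℓ₂) ∈ P.edges) :
    Answers S P ℓ₁ V (.assign a) ℓ₂ (V ∪ S.writ a) := by
  rintro c c' _ hc rfl
  exact ⟨S.post a c, .single ⟨.assign a, he, rfl⟩, S.eqOn_post_post a hc⟩

theorem answers_assign_of_mem_of_disjoint (he : (ℓ₁, .assign a, ℓ₂) ∈ P.edges)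
    (hV : Disjoint V (S.rdAsgn a)) : Answers S P ℓ₁ V (.assign a) ℓ₂ (V \ S.writ a) := by
  rintro c c' _ hc rfl
  exact ⟨S.post a c, .single ⟨.assign a, he, rfl⟩, S.eqOn_post_post_diff hc hV⟩

theorem answers_assign_self (S : Semantics Var Val Cond Asgn) (P : CFA Loc Cond Asgn) (ℓ : Loc)
    (V : Set Var) (a : Asgn) : Answers S P ℓ V (.assign a) ℓ (V ∪ S.writ a) := by
  rintro c c' _ hc rfl
  exact ⟨c, .refl, (S.eqOn_post_left a hc.symm).symm⟩

theorem Resync.answers_assume (h : Resync S P ℓ V ℓp W) (b' : Cond) :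
    Answers S P ℓ V (.assume b') ℓp W := by
  rintro c c' _ hc ⟨-, rfl⟩
  exact h.exists_reflTransGen_step hc

theorem Resync.answers_assume_of_matches (h : Resync S P ℓ V ℓp W)
    (he : (ℓp, .assume b, ℓ₂) ∈ P.edges) (hm : Matches S b b') (hW : Disjoint W (S.rdCond b')) :
    Answers S P ℓ V (.assume b') ℓ₂ W := by
  rintro c c' _ hc ⟨hsat, rfl⟩
  obtain ⟨d, hd, hdc⟩ := h.exists_reflTransGen_step hc
  have hsat' : S.Sat d b' :=
    (S.sat_congr b' d _ fun _ hx => hdc (hW.subset_compl_left hx)).2 hsat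
  exact ⟨d, hd.tail ⟨_, he, hm.sat hsat', rfl⟩, hdc⟩

/-- What a call `process (n, g', u) W` may rely on if the modified variables of `n` are `V`.  An
indicator `u` need not be justified: reporting too many of them does no harm. -/
def IsSuccessor (S : Semantics Var Val Cond Asgn) (P : CFA Loc Cond Asgn) (n : Loc × Loc')
    (V : Set Var) (g' : Edge Loc' Cond Asgn) : Node Loc Loc' → Set Var → Prop
  | .indicator ℓ', _ => ℓ' = g'.2.2
  | .aligned m, W =>
    AlignedSucc S P n.1 g'.2.1 m.1 ∧ m.2 = g'.2.2 ∧ Answers S P n.1 V g'.2.1 m.1 W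

theorem ExploreEdge.exists_isSuccessor {P' : CFA Loc' Cond Asgn} {n : Loc × Loc'}
    {g' : Edge Loc' Cond Asgn} {s t : State Var Cond Asgn Loc Loc'}
    (h : ExploreEdge S P P' n g' s t) :
    ∃ u W, IsSuccessor S P n (s.modified n) g' u W ∧ t = s.process P P' n g' u W := by
  cases h with
  | assignMatchAffected he _ =>
    exact ⟨.aligned _, _, ⟨.assignMatch he, rfl, answers_assign_of_mem he⟩, rfl⟩
  | assignMatchUnaffected he hV =>
    exact ⟨.aligned _, _, ⟨.assignMatch he, rfl,
      answers_assign_of_mem_of_disjoint he (disjoint_iff_inter_eq_empty.2 hV)⟩, rfl⟩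
  | @assignNew _ _ ℓ₂' hn =>
    exact ⟨.aligned (n.1, ℓ₂'), _, ⟨.assignNew hn, rfl, answers_assign_self ..⟩, rfl⟩
  | assumeMatchAffected => exact ⟨.indicator _, ∅, rfl, rfl⟩
  | assumeMatchUnaffected hr hne he hm hW =>
    have hW' := (disjoint_iff_inter_eq_empty.2 hW).mono_right subset_union_right
    exact ⟨.aligned _, _,
      ⟨.assumeMatch hr hne he hm, rfl, hr.answers_assume_of_matches he hm hW'⟩, rfl⟩
  | assumeNew hr hn => exact ⟨.aligned _, _, ⟨.assumeNew hr hn, rfl, hr.answers_assume _⟩, rfl⟩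

end Answers

/-! ### Invariants of the detector -/

section Invariants

variable {Var Val Cond Asgn Loc Loc' : Type*} {S : Semantics Var Val Cond Asgn}
  {P : CFA Loc Cond Asgn} {P' : CFA Loc' Cond Asgn} {s t : State Var Cond Asgn Loc Loc'}
  {n : Loc × Loc'} {g' : Edge Loc' Cond Asgn} {u : Node Loc Loc'} {V W : Set Var}

/-- The information order on detector states: in a later state `t`, alignment points visited in `s`
are only given up in favour of indicators. -/
structure State.Le (s t : State Var Cond Asgn Loc Loc') : Prop where
  edges : s.edges ⊆ t.edges
  bad : s.bad ⊆ t.bad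
  modified : ∀ n, s.modified n ⊆ t.modified n
  visited : ∀ n ∈ s.visited, n ∈ t.visited ∨ n.2 ∈ t.bad

theorem State.le_processIndicator (s : State Var Cond Asgn Loc Loc') (n : Loc × Loc')
    (g' : Edge Loc' Cond Asgn) (ℓ' : Loc') : s.Le (s.processIndicator n g' ℓ') where
  edges := subset_union_left
  bad := subset_union_left
  modified _ := subset_rfl
  visited m hm := by
    by_cases h : m.2 = ℓ'
    exacts [.inr (.inr h), .inl ⟨hm, h⟩]

theorem State.process_aligned_of_err (s : State Var Cond Asgn Loc Loc') (n : Loc × Loc')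
    (g' : Edge Loc' Cond Asgn) {m : Loc × Loc'} (W : Set Var) (h : m.1 ≠ P.err ∧ m.2 = P'.err) :
    s.process P P' n g' (.aligned m) W = s.processIndicator n g' m.2 := by
  rw [State.process, if_pos h, h.2]

theorem State.le_process (P : CFA Loc Cond Asgn) (P' : CFA Loc' Cond Asgn)
    (s : State Var Cond Asgn Loc Loc') (n : Loc × Loc') (g' : Edge Loc' Cond Asgn)
    (u : Node Loc Loc') (W : Set Var) : s.Le (s.process P P' n g' u W) := by
  cases u with
  | indicator ℓ' => exact s.le_processIndicator n g' ℓ'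
  | aligned m =>
    by_cases h : m.1 ≠ P.err ∧ m.2 = P'.err
    · rw [s.process_aligned_of_err n g' W h]
      exact s.le_processIndicator n g' m.2
    · rw [State.process, if_neg h]
      refine ⟨subset_union_left, subset_rfl, fun k => ?_, fun k hk => .inl ?_⟩
      · dsimp only
        split_ifs
        exacts [subset_union_left, subset_rfl]
      · dsimp only
        split_ifs
        exacts [hk, .inl hk]

/-- The alignment points whose outgoing edges the detector does not intend to explore any more,
except those where `P` is in its error location, which are never explored. -/
def State.settled (P : CFA Loc Cond Asgn) (s : State Var Cond Asgn Loc Loc') : Set (Loc × Loc') :=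
  {n ∈ s.visited | n.1 ≠ P.err ∧ n ∉ s.waitlist}

/- A point whose set of modified variables grows is put on the waitlist. -/
theorem State.settled_process {k : Loc × Loc'} (hk : k ∈ (s.process P P' n g' u W).settled P) :
    k ∈ s.settled P ∧ (s.process P P' n g' u W).modified k = s.modified k := by
  obtain ⟨hv, hne, hw⟩ := hk
  have hind {ℓ' : Loc'} (hv : k ∈ (s.processIndicator n g' ℓ').visited)
      (hw : k ∉ (s.processIndicator n g' ℓ').waitlist) : k ∈ s.settled P :=
    ⟨hv.1, hne, fun h => hw ⟨h, hv.2⟩⟩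
  cases u with
  | indicator ℓ' => exact ⟨hind hv hw, rfl⟩
  | aligned m =>
    by_cases h : m.1 ≠ P.err ∧ m.2 = P'.err
    · rw [s.process_aligned_of_err n g' W h] at hv hw ⊢
      exact ⟨hind hv hw, rfl⟩
    rw [State.process, if_neg h] at hv hw ⊢
    by_cases hkm : k = m ∧ m.2 ∉ s.bad
    · obtain ⟨rfl, hb⟩ := hkm
      by_cases hnew : k ∉ s.visited ∨ ¬ W ⊆ s.modified k
      · exact absurd (.inr rfl) (if_pos (⟨hb, hne, hnew⟩ : _ ∧ _ ∧ _) ▸ hw)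
      · rw [not_or, not_not, not_not] at hnew
        refine ⟨⟨hnew.1, hne, fun hk => hw ?_⟩, ?_⟩ <;> simp_all
    · simp only [if_neg hkm, and_true]
      refine ⟨?_, hne, fun hk => hw ?_⟩
      · by_cases hb : m.2 ∈ s.bad <;> simp_all
      · dsimp only
        split_ifs
        exacts [.inl hk, hk]

/-- In the returned graph, the edge `g'` will lead from the alignment point `n` to an indicator. -/
def State.LeadsToBad (s : State Var Cond Asgn Loc Loc') (n : Loc × Loc')
    (g' : Edge Loc' Cond Asgn) : Prop :=
  g'.2.2 ∈ s.bad ∧ ((.aligned n, g', .indicator g'.2.2) ∈ s.edges ∨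
    ∃ ℓ, (.aligned n, g', .aligned (ℓ, g'.2.2)) ∈ s.edges)

/-- The edge `g'` has been explored from the alignment point `n` with modified variables `V`, and
the outcome is recorded in `s`. -/
def State.Explored (S : Semantics Var Val Cond Asgn) (P : CFA Loc Cond Asgn)
    (s : State Var Cond Asgn Loc Loc') (n : Loc × Loc') (V : Set Var)
    (g' : Edge Loc' Cond Asgn) : Prop :=
  s.LeadsToBad n g' ∨ ∃ m ∈ s.visited, m.2 = g'.2.2 ∧ (.aligned n, g', .aligned m) ∈ s.edges ∧
    Answers S P n.1 V g'.2.1 m.1 (s.modified m)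

theorem State.LeadsToBad.mono (hst : s.Le t) (h : s.LeadsToBad n g') : t.LeadsToBad n g' := by
  obtain ⟨hb, he⟩ := h
  exact ⟨hst.bad hb, he.imp (@hst.edges _) (Exists.imp fun _ he => hst.edges he)⟩

theorem State.Explored.mono (hst : s.Le t) (h : s.Explored S P n V g') :
    t.Explored S P n V g' := by
  rcases h with h | ⟨⟨ℓ, _⟩, hm, rfl, he, hans⟩
  · exact .inl (h.mono hst)
  · rcases hst.visited _ hm with hm | hb
    · exact .inr ⟨_, hm, rfl, hst.edges he, hans.mono (hst.modified _)⟩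
    · exact .inl ⟨hb, .inr ⟨ℓ, hst.edges he⟩⟩

theorem State.explored_process (P' : CFA Loc' Cond Asgn) (s : State Var Cond Asgn Loc Loc')
    (hu : IsSuccessor S P n V g' u W) :
    (s.process P P' n g' u W).Explored S P n V g' := by
  cases u with
  | indicator ℓ' =>
    obtain rfl := hu
    exact .inl ⟨.inr rfl, .inl (.inr rfl)⟩
  | aligned m =>
    obtain ⟨ℓ, ℓ'⟩ := m
    obtain ⟨-, rfl, hans⟩ := hu
    by_cases h : ℓ ≠ P.err ∧ g'.2.2 = P'.err
    · rw [s.process_aligned_of_err n g' W h]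
      exact .inl ⟨.inr rfl, .inl (.inr rfl)⟩
    · rw [State.process, if_neg h]
      by_cases hb : g'.2.2 ∈ s.bad
      · exact .inl ⟨hb, .inr ⟨ℓ, .inr rfl⟩⟩
      · exact .inr ⟨(ℓ, g'.2.2), by simp [hb], rfl, .inr rfl, hans.mono (by simp [hb])⟩

/-- The part of the loop invariant that does not depend on which edges have been explored. -/
structure State.WellFormed (S : Semantics Var Val Cond Asgn) (P : CFA Loc Cond Asgn)
    (P' : CFA Loc' Cond Asgn) (s : State Var Cond Asgn Loc Loc') : Prop where
  init_visited : (P.init, P'.init) ∈ s.visited ∨ P'.init ∈ s.bad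
  notMem_bad : ∀ n ∈ s.visited, n.2 ∉ s.bad
  eq_of_err : ∀ n ∈ s.visited, n.2 = P'.err → n.1 = P.err ∨ n = (P.init, P'.init)
  alignedSucc : ∀ n g' m, (.aligned n, g', .aligned m) ∈ s.edges →
    AlignedSucc S P n.1 g'.2.1 m.1 ∧ m.2 = g'.2.2

theorem State.WellFormed.processIndicator (hs : s.WellFormed S P P') (n : Loc × Loc')
    (g' : Edge Loc' Cond Asgn) (ℓ' : Loc') : (s.processIndicator n g' ℓ').WellFormed S P P' where
  init_visited := hs.init_visited.elim ((s.le_processIndicator n g' ℓ').visited _) (.inr ∘ .inl)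
  notMem_bad k hk hb := hb.elim (hs.notMem_bad k hk.1) hk.2
  eq_of_err k hk := hs.eq_of_err k hk.1
  alignedSucc k h' m he := hs.alignedSucc k h' m (he.resolve_right (by simp))

theorem State.WellFormed.process (hs : s.WellFormed S P P') (hu : IsSuccessor S P n V g' u W) :
    (s.process P P' n g' u W).WellFormed S P P' := by
  cases u with
  | indicator ℓ' => exact hs.processIndicator n g' ℓ'
  | aligned m =>
    by_cases h : m.1 ≠ P.err ∧ m.2 = P'.err
    · rw [s.process_aligned_of_err n g' W h]
      exact hs.processIndicator n g' m.2
    classical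
    have hle := s.le_process P P' n g' (.aligned m) W
    rw [State.process, if_neg h] at hle ⊢
    have hvisited {k : Loc × Loc'} (hk : k ∈ if m.2 ∉ s.bad then s.visited ∪ {m} else s.visited) :
        k ∈ s.visited ∨ k = m ∧ m.2 ∉ s.bad := by
      split_ifs at hk with hb
      exacts [.inl hk, hk.imp_right fun hk => ⟨hk, hb⟩]
    refine ⟨hs.init_visited.imp_left fun hv => ?_, fun k hk => ?_, fun k hk herr => ?_, ?_⟩
    · exact (hle.visited _ hv).resolve_right (hs.notMem_bad _ hv)
    · rcases hvisited hk with hk | ⟨rfl, hb⟩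
      exacts [hs.notMem_bad k hk, hb]
    · rcases hvisited hk with hk | ⟨rfl, -⟩
      exacts [hs.eq_of_err k hk herr, .inl (by_contra fun hne => h ⟨hne, herr⟩)]
    · rintro k h' l (he | he)
      · exact hs.alignedSucc k h' l he
      · cases he
        exact ⟨hu.1, hu.2.1⟩

/-- The loop invariant of the detector, where the edges in `pending` are still to be explored. -/
structure State.Invariant (S : Semantics Var Val Cond Asgn) (P : CFA Loc Cond Asgn)
    (P' : CFA Loc' Cond Asgn) (pending : Set ((Loc × Loc') × Edge Loc' Cond Asgn))
    (s : State Var Cond Asgn Loc Loc') : Prop extends s.WellFormed S P P' where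
  explored : ∀ n ∈ s.settled P, ∀ g' ∈ P'.edges, g'.1 = n.2 → (n, g') ∉ pending →
    s.Explored S P n (s.modified n) g'

theorem State.invariant_start (S : Semantics Var Val Cond Asgn) (P : CFA Loc Cond Asgn)
    (P' : CFA Loc' Cond Asgn) : (State.start P P').Invariant S P P' ∅ where
  init_visited := .inl rfl
  notMem_bad _ _ := id
  eq_of_err _ hn _ := .inr hn
  alignedSucc _ _ _ h := h.elim
  explored _ hn := absurd hn.1 hn.2.2

theorem State.Invariant.process {pending : Set ((Loc × Loc') × Edge Loc' Cond Asgn)}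
    (hs : s.Invariant S P P' pending) (hu : IsSuccessor S P n (s.modified n) g' u W) :
    (s.process P P' n g' u W).Invariant S P P' (pending \ {(n, g')}) where
  toWellFormed := hs.toWellFormed.process hu
  explored k hk h' hh' hsrc hpend := by
    obtain ⟨hk, hmod⟩ := State.settled_process hk
    rw [hmod]
    by_cases heq : (k, h') = (n, g')
    · obtain ⟨rfl, rfl⟩ := Prod.mk.inj heq
      exact s.explored_process P' hu
    · exact (hs.explored k hk h' hh' hsrc fun h => hpend ⟨h, heq⟩).mono (s.le_process ..)

theorem State.Invariant.exploreEdges {gs : List (Edge Loc' Cond Asgn)}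
    (hs : s.Invariant S P P' {p | p.1 = n ∧ p.2 ∈ gs}) (h : ExploreEdges S P P' n gs s t) :
    t.Invariant S P P' ∅ := by
  induction h with
  | nil => simpa using hs
  | @cons g' gs _ _ _ he _ ih =>
    obtain ⟨u, W, hu, rfl⟩ := he.exists_isSuccessor
    have hpend : {p : (Loc × Loc') × _ | p.1 = n ∧ p.2 ∈ g' :: gs} \ {(n, g')} ⊆
        {p | p.1 = n ∧ p.2 ∈ gs} := by
      rintro ⟨_, h'⟩ ⟨⟨rfl, hmem⟩, hne⟩
      exact ⟨rfl, (List.mem_cons.1 hmem).resolve_left fun h => hne (by simp_all)⟩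
    have hs' := hs.process hu
    exact ih ⟨hs'.toWellFormed, fun k hk h' hh' hsrc hp =>
      hs'.explored k hk h' hh' hsrc fun h => hp (hpend h)⟩

theorem State.Invariant.iteration (hs : s.Invariant S P P' ∅) (h : Iteration S P P' s t) :
    t.Invariant S P P' ∅ := by
  obtain ⟨n, -, gs, -, hgs, hex⟩ := h
  refine State.Invariant.exploreEdges (s := { s with waitlist := s.waitlist \ {n} })
    ⟨⟨hs.init_visited, hs.notMem_bad, hs.eq_of_err, hs.alignedSucc⟩,
      fun k ⟨hv, hne, hw⟩ h' hh' hsrc hp => ?_⟩ hex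
  refine hs.explored k ⟨hv, hne, fun hk => hw ⟨hk, ?_⟩⟩ h' hh' hsrc id
  rintro rfl
  exact hp ⟨rfl, (hgs h').2 ⟨hh', hsrc⟩⟩

theorem State.invariant_of_reflTransGen (h : ReflTransGen (Iteration S P P') (State.start P P') s) :
    s.Invariant S P P' ∅ := by
  induction h with
  | refl => exact State.invariant_start S P P'
  | tail _ hit ih => exact ih.iteration hit

end Invariants

/-! ### The returned graph -/

section Output

variable {Var Val Cond Asgn Loc Loc' : Type*} {S : Semantics Var Val Cond Asgn}
  {P : CFA Loc Cond Asgn} {P' : CFA Loc' Cond Asgn} {s : State Var Cond Asgn Loc Loc'}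

/-- The graph returned by the detector unless the initial location is an indicator: the second
branch of `State.output`. -/
def State.graph (P : CFA Loc Cond Asgn) (P' : CFA Loc' Cond Asgn)
    (s : State Var Cond Asgn Loc Loc') : Graph (Node Loc Loc') (Edge Loc' Cond Asgn) where
  nodes := Node.aligned '' s.visited ∪ Node.indicator '' s.bad
  edges := {e | e.1 ∈ Node.aligned '' s.visited ∧ e.2.1 ∈ P'.edges ∧
    e.2.2 ∈ Node.aligned '' s.visited ∪ Node.indicator '' s.bad ∧
    (e ∈ s.edges ∨
      ∃ ℓ' ∈ s.bad, e.2.2 = .indicator ℓ' ∧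
        ∃ ℓ, (e.1, e.2.1, Node.aligned (ℓ, ℓ')) ∈ s.edges)}
  init := .aligned (P.init, P'.init)
  Δ := Node.indicator '' s.bad

theorem State.aligned_mem_graph_edges {n m : Loc × Loc'} {g' : Edge Loc' Cond Asgn} :
    (.aligned n, g', .aligned m) ∈ (s.graph P P').edges ↔
      n ∈ s.visited ∧ g' ∈ P'.edges ∧ m ∈ s.visited ∧
        (.aligned n, g', .aligned m) ∈ s.edges := by
  simp [State.graph, -Prod.exists]

theorem State.LeadsToBad.exists_mem_graph_edges {n : Loc × Loc'} {g' : Edge Loc' Cond Asgn}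
    (h : s.LeadsToBad n g') (hn : n ∈ s.visited) (hg : g' ∈ P'.edges) :
    ∃ u, (.aligned n, g', u) ∈ (s.graph P P').edges := by
  obtain ⟨hb, he⟩ := h
  exact ⟨.indicator _, ⟨n, hn, rfl⟩, hg, .inr ⟨_, hb, rfl⟩,
    he.imp_right fun he => ⟨_, hb, rfl, he⟩⟩

/-- The simulation between the returned graph and `P'`: at an alignment point `(ℓ, ℓ')`, the
original program can be executed from `c₀` to `ℓ` so that the data states of the two programs differ
only in the recorded modified variables.  Every indicator is related to all configurations, since the
graph need not be followed any further. -/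
def State.Tracks (S : Semantics Var Val Cond Asgn) (P : CFA Loc Cond Asgn)
    (s : State Var Cond Asgn Loc Loc') (c₀ : Var → Val) :
    Node Loc Loc' → Loc' × (Var → Val) → Prop
  | .aligned n, x => n ∈ s.visited ∧ n.2 = x.1 ∧
    ∃ c, ReflTransGen (P.Step S) (P.init, c₀) (n.1, c) ∧ EqOn c x.2 (s.modified n)ᶜ
  | .indicator ℓ', _ => ℓ' ∈ s.bad

variable {c₀ : Var → Val} {n m : Loc × Loc'} {x y : Loc' × (Var → Val)} {op : Op Cond Asgn}

theorem State.Tracks.fst_ne_err (h : s.Tracks S P c₀ (.aligned n) x) (hc₀ : P.Safe S c₀) :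
    n.1 ≠ P.err := by
  obtain ⟨-, -, c, hreach, -⟩ := h
  exact fun herr => hc₀ c (herr ▸ hreach)

theorem State.Tracks.ne_err (h : s.Tracks S P c₀ (.aligned n) x) (hc₀ : P.Safe S c₀)
    (hs : s.WellFormed S P P') (hinit : P'.init = P'.err → P.init = P.err) : x.1 ≠ P'.err := by
  intro herr
  rcases hs.eq_of_err n h.1 (h.2.1.trans herr) with hne | rfl
  · exact h.fst_ne_err hc₀ hne
  · exact h.fst_ne_err hc₀ (hinit (h.2.1.trans herr))

theorem State.Tracks.explored (h : s.Tracks S P c₀ (.aligned n) x) (hc₀ : P.Safe S c₀)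
    (hs : s.Invariant S P P' ∅) (hw : s.waitlist = ∅) (hg : (x.1, op, y.1) ∈ P'.edges) :
    s.Explored S P n (s.modified n) (x.1, op, y.1) :=
  hs.explored n ⟨h.1, h.fst_ne_err hc₀, hw ▸ id⟩ _ hg h.2.1.symm id

theorem State.Tracks.step (h : s.Tracks S P c₀ (.aligned n) x) (hc₀ : P.Safe S c₀)
    (hs : s.Invariant S P P' ∅) (hw : s.waitlist = ∅) (hP : P.Deterministic S)
    (he : (.aligned n, (x.1, op, y.1), .aligned m) ∈ (s.graph P P').edges)
    (hop : OpStep S op x.2 y.2) : s.Tracks S P c₀ (.aligned m) y := by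
  obtain ⟨-, hg, hm, he⟩ := State.aligned_mem_graph_edges.1 he
  obtain ⟨hsucc, hm₂⟩ := hs.alignedSucc _ _ _ he
  rcases h.explored hc₀ hs hw hg with ⟨hb, -⟩ | ⟨k, -, hk₂, he', hans⟩
  · exact absurd (hm₂ ▸ hb) (hs.notMem_bad m hm)
  obtain rfl : m = k :=
    Prod.ext (hsucc.unique hP hop (hs.alignedSucc _ _ _ he').1) (hm₂.trans hk₂.symm)
  obtain ⟨-, -, c, hreach, hc⟩ := h
  obtain ⟨d, hd, hdy⟩ := hans hc hop
  exact ⟨hm, hm₂, d, hreach.trans hd, hdy⟩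

theorem State.Invariant.isSimulation_graph (hs : s.Invariant S P P' ∅) (hw : s.waitlist = ∅)
    (hP : P.Deterministic S) (hinit : P'.init = P'.err → P.init = P.err) (hc₀ : P.Safe S c₀) :
    (s.graph P P').IsSimulation S P' (s.Tracks S P c₀) where
  ne_err {u _} h hu := by
    cases u with
    | aligned n => exact h.ne_err hc₀ hs.toWellFormed hinit
    | indicator ℓ' => exact absurd ⟨ℓ', h, rfl⟩ hu
  exists_edge {u _ _ _} h hu hg _ := by
    cases u with
    | aligned n =>
      rcases h.explored hc₀ hs hw hg with hbad | ⟨m, hm, -, he, -⟩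
      · exact hbad.exists_mem_graph_edges h.1 hg
      · exact ⟨.aligned m, State.aligned_mem_graph_edges.2 ⟨h.1, hg, hm, he⟩⟩
    | indicator ℓ' => exact absurd ⟨ℓ', h, rfl⟩ hu
  step {u v _ _ _} h he hop := by
    obtain ⟨n, -, rfl⟩ := he.1
    rcases he.2.2.1 with ⟨m, -, rfl⟩ | ⟨ℓ', hb, rfl⟩
    exacts [h.step hc₀ hs hw hP he hop, hb]

theorem State.Invariant.isDifferenceGraph_graph (hs : s.Invariant S P P' ∅) (hw : s.waitlist = ∅)
    (hP : P.Deterministic S) (hbad : P'.init ∉ s.bad)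
    (hinit : P'.init = P'.err → P.init = P.err) : IsDifferenceGraph S P P' (s.graph P P') := by
  have hvisited := hs.init_visited.resolve_right hbad
  refine isDifferenceGraph_of_isSimulation (.inl ⟨_, hvisited, rfl⟩) subset_union_right
    (fun _ _ _ he => ⟨.inl he.1, he.2.1, he.2.2.1⟩) ?_ fun c₀ hc₀ =>
      ⟨_, hs.isSimulation_graph hw hP hinit hc₀, hvisited, rfl, c₀, .refl, fun _ _ => rfl⟩
  rintro _ _ _ ⟨⟨n, -, rfl⟩, -⟩ ⟨ℓ', -, hn⟩
  exact nomatch hn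

end Output

end DiffVerif

theorem theorem2_general {Var Val Cond Asgn Loc Loc' : Type*}
    (S : DiffVerif.Semantics Var Val Cond Asgn)
    (P : DiffVerif.CFA Loc Cond Asgn) (P' : DiffVerif.CFA Loc' Cond Asgn)
    (hP : P.Deterministic S)
    (D : DiffVerif.Graph (DiffVerif.Node Loc Loc') (DiffVerif.Edge Loc' Cond Asgn))
    (hD : DiffVerif.DetectorReturns S P P' D) :
    DiffVerif.IsDifferenceGraph S P P' D := by
  obtain ⟨s, hrun, hw, rfl⟩ := hD
  have hs := DiffVerif.State.invariant_of_reflTransGen hrun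
  unfold DiffVerif.State.output
  split_ifs with h
  · exact DiffVerif.isDifferenceGraph_singleton S P P' _
  · rw [not_or, not_and_not_right] at h
    exact hs.isDifferenceGraph_graph hw hP h.1 h.2

theorem theorem2 {Var Val Cond Asgn Loc Loc' : Type*}
    (S : DiffVerif.Semantics Var Val Cond Asgn)
    (P : DiffVerif.CFA Loc Cond Asgn) (P' : DiffVerif.CFA Loc' Cond Asgn)
    (hP : P.Deterministic S) (hP' : P'.Deterministic S)
    (D : DiffVerif.Graph (DiffVerif.Node Loc Loc') (DiffVerif.Edge Loc' Cond Asgn))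
    (hD : DiffVerif.DetectorReturns S P P' D) :
    DiffVerif.IsDifferenceGraph S P P' D :=
  theorem2_general S P P' hP D hD
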